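/- For real $\alpha\in(0,1)$ let $E_{\alpha,1}(z)=\sum_{k=0}^{\infty}\frac{z^k}{\Gamma(\alpha k+1)}$ be the Mittag-Leffler function, and for $f\in C^1([0,T])$ let $$D_*^{\alpha}f(t)=\frac{1}{1-\alpha}\int_0^t f'(s)\,E_{\alpha,1}\!\left(-\alpha\frac{(t-s)^{\alpha}}{1-\alpha}\right)ds,\qquad t\in[0,T],$$ be its Atangana–Baleanu fractional derivative of order $\alpha$ (with base point $0$ and normalization $M(\alpha)=1$). Let $f\in C^1([0,T])$ be real-valued. a) If $f$ attains its maximum over $[0,T]$ at a point $t_0\in[0,T]$, then for every $0<\alpha<1$ $$D_*^{\alpha}f(t_0)\ \ge\ \frac{1}{1-\alpha}\,E_{\alpha,1}\!\left(-\alpha\frac{t_0^{\alpha}}{1-\alpha}\right)\bigl(f(t_0)-f(0)\bigr)\ \ge\ 0.$$ b) If $f$ attains its minimum over $[0,T]$ at a point $t_0\in[0,T]$, then for every $0<\alpha<1$ $$D_*^{\alpha}f(t_0)\ \le\ \frac{1}{1-\alpha}\,E_{\alpha,1}\!\left(-\alpha\frac{t_0^{\alpha}}{1-\alpha}\right)\bigl(f(t_0)-f(0)\bigr)\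 \le\ 0.$$ -/

import Mathlib

open Set

noncomputable section

/-- The two-parameter Mittag-Leffler function `E_{α,β}(z) = ∑_{k ≥ 0} z ^ k / Γ(α k + β)`
of a real variable. -/
def mittagLeffler (α β z : ℝ) : ℝ :=
  ∑' k : ℕ, z ^ k / Real.Gamma (α * k + β)

/-- The Atangana-Baleanu fractional derivative (in the Caputo sense, normalization `M(α) = 1`)
of order `α` with base point `a`, at the point `t`:
`1 / (1 - α) * ∫ s in a..t, f'(s) * E_{α,1}(-α (t - s) ^ α / (1 - α))`.
Only the values of `f` on `[a, t]` matter, since the derivative enters through its values on the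
open interval `(a, t)`. -/
def abDeriv (α a : ℝ) (f : ℝ → ℝ) (t : ℝ) : ℝ :=
  1 / (1 - α) *
    ∫ s in a..t, deriv f s * mittagLeffler α 1 (-α * ((t - s) ^ α / (1 - α)))

end

/-!
Write `E = E_{α,1}` and `y_μ(s) = E(μ s ^ α)`. Integration by parts against the weight
`s ↦ E(-α (t₀ - s) ^ α / (1 - α))` gives the estimate as soon as this weight is nonnegative and
nondecreasing on `[0, t₀]` (`integral_monotone_mul_deriv_le`), that is, as soon as `E` is
nonnegative and monotone on `(-∞, 0]`. No integral representation or complete monotonicity of `E`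
is needed for this; both facts come from a maximum principle.

* Term by term, by the Beta integral, `y_μ` is an eigenfunction of the Caputo derivative of order
  `α`: `∫ s in 0..t, (t - s) ^ (-α) * y_μ'(s) = Γ(1 - α) μ y_μ(t)` (`caputo_mittagLeffler`).
* The Caputo derivative of a function is nonpositive at a minimum over `[0, t]` attained at the
  right endpoint (`caputo_integral_nonpos_of_isMinOn`). This is integration by parts with the
  increasing weight `(t - s) ^ (-α)`.
* If `y_μ` with `μ < 0` had a negative minimum over `[0, 1]`, its Caputo derivative there would be
  positive, a contradiction; hence `E ≥ 0` on `(-∞, 0]` (`mittagLeffler_nonneg`). The same argument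
  for `y_ν - y_μ` with `μ ≤ ν ≤ 0`, using `y_ν ≥ 0`, gives `y_μ ≤ y_ν`, and at `s = 1` this is
  `E μ ≤ E ν` (`mittagLeffler_monotoneOn`).

The case of a maximum is that of a minimum applied to `-f`.
-/

open MeasureTheory Filter Topology

/-! ### The series and its derivative -/

/-- The gain of the Gamma function over a step `α` tends to infinity: by log-convexity it is at
least the `α`-th power of the gain over the preceding unit step. -/
lemma rpow_mul_Gamma_le_Gamma_add {α x : ℝ} (hα : 0 < α) (hx : 1 < x) :
    (x - 1) ^ α * Real.Gamma x ≤ Real.Gamma (x + α) := by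
  have h := Real.convexOn_log_Gamma.slope_mono_adjacent (x := x - 1) (y := x) (z := x + α)
    (by simp; linarith) (by simp; linarith) (by linarith) (by linarith)
  have hG : Real.Gamma x = (x - 1) * Real.Gamma (x - 1) := by
    have := Real.Gamma_add_one (s := x - 1) (by linarith)
    rwa [sub_add_cancel] at this
  have h1 : 0 < x - 1 := by linarith
  have h2 : 0 < Real.Gamma (x - 1) := Real.Gamma_pos_of_pos h1
  have h3 : 0 < Real.Gamma x := Real.Gamma_pos_of_pos (by linarith)
  have h4 : 0 < Real.Gamma (x + α) := Real.Gamma_pos_of_pos (by linarith)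
  simp only [Function.comp_apply, sub_sub_cancel, div_one, add_sub_cancel_left] at h
  have hlog : Real.log (Real.Gamma x) = Real.log (x - 1) + Real.log (Real.Gamma (x - 1)) := by
    rw [hG, Real.log_mul h1.ne' h2.ne']
  rw [le_div_iff₀ hα] at h
  rw [← Real.log_le_log_iff (by positivity) h4, Real.log_mul (by positivity) h3.ne',
    Real.log_rpow h1]
  nlinarith

lemma mittagLeffler_arg_pos {α : ℝ} (hα : 0 < α) (k : ℕ) : 0 < α * k + 1 := by positivity

lemma summable_mittagLeffler {α : ℝ} (hα : 0 < α) (z : ℝ) :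
    Summable fun k : ℕ => z ^ k / Real.Gamma (α * k + 1) := by
  rcases eq_or_ne z 0 with rfl | hz
  · exact summable_of_ne_finset_zero (s := {0}) fun k hk => by
      simp at hk; simp [hk]
  refine summable_of_ratio_test_tendsto_lt_one (l := 0) one_pos (Eventually.of_forall fun k => ?_) ?_
  · exact div_ne_zero (pow_ne_zero _ hz) (Real.Gamma_pos_of_pos (mittagLeffler_arg_pos hα k)).ne'
  have hlim : Tendsto (fun k : ℕ => |z| / (α * k) ^ α) atTop (𝓝 0) := by
    refine Tendsto.div_atTop tendsto_const_nhds ((tendsto_rpow_atTop hα).comp ?_)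
    exact tendsto_natCast_atTop_atTop.const_mul_atTop hα
  refine squeeze_zero' (Eventually.of_forall fun k => by positivity) ?_ hlim
  filter_upwards [eventually_gt_atTop 0] with k hk
  have hk' : (0 : ℝ) < k := by exact_mod_cast hk
  have hp := Real.Gamma_pos_of_pos (mittagLeffler_arg_pos hα k)
  have hp' := Real.Gamma_pos_of_pos (mittagLeffler_arg_pos hα (k + 1))
  have h := rpow_mul_Gamma_le_Gamma_add hα (x := α * k + 1) (by nlinarith [mul_pos hα hk'])
  rw [add_sub_cancel_right, show α * (k : ℝ) + 1 + α = α * ((k + 1 : ℕ) : ℝ) + 1 by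
    push_cast; ring] at h
  have hz' : 0 < |z| := abs_pos.2 hz
  rw [norm_div, norm_div, norm_pow, norm_pow, Real.norm_eq_abs, Real.norm_of_nonneg hp.le,
    Real.norm_of_nonneg hp'.le, div_div_div_eq, pow_succ, div_le_div_iff₀ (by positivity)
    (by positivity)]
  calc |z| ^ k * |z| * Real.Gamma (α * k + 1) * (α * k) ^ α
      = |z| ^ k * |z| * ((α * k) ^ α * Real.Gamma (α * k + 1)) := by ring
    _ ≤ |z| ^ k * |z| * Real.Gamma (α * ((k + 1 : ℕ) : ℝ) + 1) := by gcongr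
    _ = _ := by ring

lemma hasDerivAt_mittagLeffler {α : ℝ} (hα : 0 < α) (z : ℝ) :
    HasDerivAt (mittagLeffler α 1)
      (∑' k : ℕ, (k + 1) * z ^ k / Real.Gamma (α * (k + 1) + 1)) z := by
  set R : ℝ := |z| + 1 with hR
  have hR1 : 1 ≤ R := by simp [hR]
  -- On the ball of radius `R ≥ 1` the derived terms are at most `k R ^ (k - 1) ≤ (2 R) ^ k`.
  have hb : ∀ (n : ℕ) (y : ℝ), y ∈ Metric.ball (0 : ℝ) R →
      ‖n * y ^ (n - 1) / Real.Gamma (α * n + 1)‖ ≤ (2 * R) ^ n / Real.Gamma (α * n + 1) := by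
    intro n y hy
    have hp := Real.Gamma_pos_of_pos (mittagLeffler_arg_pos hα n)
    have hy' : |y| ≤ R := by simpa using (mem_ball_zero_iff.1 hy).le
    rw [norm_div, norm_mul, norm_pow, Real.norm_of_nonneg hp.le, Real.norm_natCast,
      Real.norm_eq_abs, mul_pow]
    have h2 : (n : ℝ) ≤ 2 ^ n := by exact_mod_cast Nat.lt_two_pow_self.le
    have h3 : |y| ^ (n - 1) ≤ R ^ n :=
      (pow_le_pow_left₀ (abs_nonneg _) hy' _).trans (pow_le_pow_right₀ hR1 (Nat.sub_le _ _))
    gcongr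
  have hz : z ∈ Metric.ball (0 : ℝ) R := by simp [hR]
  have hd := hasDerivAt_tsum_of_isPreconnected (summable_mittagLeffler hα (2 * R))
    Metric.isOpen_ball (convex_ball (0 : ℝ) R).isPreconnected
    (g := fun (n : ℕ) y => y ^ n / Real.Gamma (α * n + 1))
    (fun n y _ => (hasDerivAt_pow n y).div_const _) hb hz (summable_mittagLeffler hα z) hz
  have hs : Summable fun n : ℕ => n * z ^ (n - 1) / Real.Gamma (α * n + 1) :=
    .of_norm_bounded (summable_mittagLeffler hα (2 * R)) fun n => hb n z hz
  rw [hs.tsum_eq_zero_add] at hd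
  have hfun : mittagLeffler α 1 = fun z => ∑' n : ℕ, z ^ n / Real.Gamma (α * n + 1) := rfl
  rw [hfun]
  refine hd.congr_deriv ?_
  simp

lemma continuous_mittagLeffler {α : ℝ} (hα : 0 < α) : Continuous (mittagLeffler α 1) :=
  continuous_iff_continuousAt.2 fun z => (hasDerivAt_mittagLeffler hα z).continuousAt

lemma mittagLeffler_zero (α : ℝ) : mittagLeffler α 1 0 = 1 := by
  rw [mittagLeffler, tsum_eq_single 0 fun k hk => by simp [hk]]
  simp

/-! ### The Caputo eigenvalue equation -/

/-- Euler's Beta integral over `[0, t]`, for real exponents. -/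
lemma integral_rpow_mul_sub_rpow {p q t : ℝ} (hp : 0 < p) (hq : 0 < q) (ht : 0 < t) :
    ∫ s in (0 : ℝ)..t, s ^ (p - 1) * (t - s) ^ (q - 1) =
      t ^ (p + q - 1) * (Real.Gamma p * Real.Gamma q / Real.Gamma (p + q)) := by
  have h := Complex.betaIntegral_scaled (p : ℂ) q ht
  rw [Complex.betaIntegral_eq_Gamma_mul_div _ _ (by simpa) (by simpa)] at h
  apply Complex.ofReal_injective
  rw [← intervalIntegral.integral_ofReal]
  push_cast
  rw [Complex.ofReal_cpow ht.le, ← Complex.Gamma_ofReal, ← Complex.Gamma_ofReal,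
    ← Complex.Gamma_ofReal]
  push_cast
  rw [← h]
  refine intervalIntegral.integral_congr fun s hs => ?_
  rw [uIcc_of_le ht.le] at hs
  simp only [Complex.ofReal_cpow hs.1, Complex.ofReal_cpow (sub_nonneg.2 hs.2)]
  push_cast
  rfl

lemma intervalIntegrable_rpow_mul_sub_rpow {p q t : ℝ} (hp : 0 < p) (hq : 0 < q) (ht : 0 < t) :
    IntervalIntegrable (fun s => s ^ (p - 1) * (t - s) ^ (q - 1)) volume 0 t := by
  -- A non-integrable function has integral zero, whereas the Beta integral is positive.
  by_contra h
  have h0 := integral_rpow_mul_sub_rpow hp hq ht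
  rw [intervalIntegral.integral_undef h] at h0
  have := Real.Gamma_pos_of_pos hp
  have := Real.Gamma_pos_of_pos hq
  have := Real.Gamma_pos_of_pos (add_pos hp hq)
  have : 0 < t ^ (p + q - 1) * (Real.Gamma p * Real.Gamma q / Real.Gamma (p + q)) := by positivity
  linarith

lemma hasDerivAt_mittagLeffler_rpow {α : ℝ} (hα : 0 < α) (μ : ℝ) {t : ℝ} (ht : 0 < t) :
    HasDerivAt (fun s => mittagLeffler α 1 (μ * s ^ α))
      (∑' k : ℕ, μ ^ (k + 1) / Real.Gamma (α * (k + 1)) * t ^ (α * (k + 1) - 1)) t := by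
  have h := (hasDerivAt_mittagLeffler hα (μ * t ^ α)).comp t
    ((Real.hasDerivAt_rpow_const (p := α) (Or.inl ht.ne')).const_mul μ)
  refine h.congr_deriv ?_
  rw [← tsum_mul_right]
  refine tsum_congr fun k => ?_
  have hk : 0 < α * ((k : ℝ) + 1) := by positivity
  rw [Real.Gamma_add_one hk.ne', show α * ((k : ℝ) + 1) - 1 = α * k + (α - 1) by ring,
    Real.rpow_add ht, Real.rpow_mul ht.le, Real.rpow_natCast, mul_pow]
  have := (Real.Gamma_pos_of_pos hk).ne'
  field_simp
  ring

/-- The function `y s = E_α(μ s ^ α)` solves `D^α y = μ y` for the Caputo derivative `D^α`, up to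
the factor `Γ(1 - α)`: term by term this is the Beta integral. -/
lemma caputo_mittagLeffler {α : ℝ} (hα : 0 < α) (hα1 : α < 1) (μ : ℝ) {t : ℝ} (ht : 0 < t) :
    IntervalIntegrable (fun s => (t - s) ^ (-α) *
        deriv (fun s => mittagLeffler α 1 (μ * s ^ α)) s) volume 0 t ∧
      ∫ s in (0 : ℝ)..t, (t - s) ^ (-α) * deriv (fun s => mittagLeffler α 1 (μ * s ^ α)) s =
        Real.Gamma (1 - α) * μ * mittagLeffler α 1 (μ * t ^ α) := by
  have hq : 0 < 1 - α := by linarith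
  set c : ℕ → ℝ := fun k => 1 / Real.Gamma (α * (k + 1)) with hc
  set G : ℕ → ℝ → ℝ := fun k s => s ^ (α * (k + 1) - 1) * (t - s) ^ (1 - α - 1) with hG
  have hp : ∀ k : ℕ, 0 < α * ((k : ℝ) + 1) := fun k => by positivity
  have hcpos : ∀ k, 0 < c k := fun k => one_div_pos.2 (Real.Gamma_pos_of_pos (hp k))
  have hGi : ∀ k, IntervalIntegrable (G k) volume 0 t := fun k =>
    intervalIntegrable_rpow_mul_sub_rpow (hp k) hq ht
  have hGint : ∀ (k : ℕ) (ν : ℝ), ν ^ (k + 1) * c k * ∫ s in (0 : ℝ)..t, G k s =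
      Real.Gamma (1 - α) * ν * ((ν * t ^ α) ^ k / Real.Gamma (α * k + 1)) := by
    intro k ν
    rw [integral_rpow_mul_sub_rpow (hp k) hq ht,
      show α * ((k : ℝ) + 1) + (1 - α) - 1 = α * k by ring,
      show α * ((k : ℝ) + 1) + (1 - α) = α * k + 1 by ring, Real.rpow_mul ht.le,
      Real.rpow_natCast, mul_pow, hc]
    have := (Real.Gamma_pos_of_pos (hp k)).ne'
    field_simp
    ring
  have hGnonneg : ∀ k, ∀ s ∈ Ioc 0 t, 0 ≤ G k s := fun k s hs =>
    mul_nonneg (Real.rpow_nonneg hs.1.le _) (Real.rpow_nonneg (sub_nonneg.2 hs.2) _)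
  have hFi : ∀ k, Integrable (fun s => μ ^ (k + 1) * c k * G k s)
      (volume.restrict (Ioc 0 t)) := fun k =>
    ((intervalIntegrable_iff_integrableOn_Ioc_of_le ht.le).1 (hGi k)).const_mul _
  have hnorm : ∀ k, ∫ s in Ioc 0 t, ‖μ ^ (k + 1) * c k * G k s‖ =
      Real.Gamma (1 - α) * |μ| * ((|μ| * t ^ α) ^ k / Real.Gamma (α * k + 1)) := by
    intro k
    rw [← hGint, intervalIntegral.integral_of_le ht.le, ← integral_const_mul]
    refine setIntegral_congr_fun measurableSet_Ioc fun s hs => ?_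
    simp only [norm_mul, norm_pow, Real.norm_eq_abs, abs_of_pos (hcpos k),
      abs_of_nonneg (hGnonneg k s hs)]
  have hsum : Summable fun k => ∫ s in Ioc 0 t, ‖μ ^ (k + 1) * c k * G k s‖ := by
    simp only [hnorm]
    exact (summable_mittagLeffler hα _).mul_left _
  have hmain := hasSum_integral_of_summable_integral_norm hFi hsum
  have heq : EqOn (fun s => ∑' k, μ ^ (k + 1) * c k * G k s) (fun s => (t - s) ^ (-α) *
      deriv (fun s => mittagLeffler α 1 (μ * s ^ α)) s) (Ioc 0 t) := by
    intro s hs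
    simp only [(hasDerivAt_mittagLeffler_rpow hα μ hs.1).deriv, ← tsum_mul_left]
    refine tsum_congr fun k => ?_
    simp only [hc, hG, show 1 - α - 1 = -α by ring]
    ring
  have hint : Integrable (fun s => ∑' k, μ ^ (k + 1) * c k * G k s)
      (volume.restrict (Ioc 0 t)) := by
    refine ⟨?_, ?_⟩
    · have hm : Measurable fun s => (t - s) ^ (-α) *
          deriv (fun s => mittagLeffler α 1 (μ * s ^ α)) s :=
        ((measurable_const.sub measurable_id).pow_const _).mul (measurable_deriv _)
      refine hm.aestronglyMeasurable.congr ?_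
      filter_upwards [ae_restrict_mem measurableSet_Ioc] with s hs using (heq hs).symm
    · refine (lintegral_mono fun s => enorm_tsum_le_tsum_enorm).trans_lt ?_
      rw [lintegral_tsum fun k => (hFi k).1.enorm]
      simp only [← ofReal_integral_norm_eq_lintegral_enorm (hFi _)]
      exact hsum.tsum_ofReal_lt_top
  constructor
  · rw [intervalIntegrable_iff_integrableOn_Ioc_of_le ht.le]
    exact IntegrableOn.congr_fun hint heq measurableSet_Ioc
  · rw [intervalIntegral.integral_of_le ht.le, ← setIntegral_congr_fun measurableSet_Ioc heq,
      ← hmain.tsum_eq, mittagLeffler, ← tsum_mul_left]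
    refine tsum_congr fun k => ?_
    rw [← hGint, intervalIntegral.integral_of_le ht.le, ← integral_const_mul]

/-! ### Extremum principle -/

/-- Integration against a monotone weight: since `u - m ≥ 0`, the term carrying the derivative of
the weight has a sign after integration by parts. -/
lemma integral_monotone_mul_deriv_le {a b m : ℝ} {w u u' : ℝ → ℝ} (hab : a ≤ b)
    (hw : ContinuousOn w (Icc a b)) (hwm : MonotoneOn w (Icc a b))
    (hwd : ∀ x ∈ Ioo a b, DifferentiableAt ℝ w x)
    (hu : ContinuousOn u (Icc a b)) (hud : ∀ x ∈ Ioo a b, HasDerivAt u (u' x) x)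
    (hui : IntervalIntegrable u' volume a b) (hum : ∀ x ∈ Icc a b, m ≤ u x) :
    ∫ x in a..b, w x * u' x ≤ w b * (u b - m) - w a * (u a - m) := by
  have hw0 : ∀ x ∈ Ioo a b, 0 ≤ deriv w x := by
    intro x hx
    have hn : Icc a b ∈ 𝓝 x := Icc_mem_nhds hx.1 hx.2
    rw [← derivWithin_of_mem_nhds hn]
    exact hwm.derivWithin_nonneg
  have hwi : IntervalIntegrable (deriv w) volume a b := by
    apply intervalIntegral.intervalIntegrable_deriv_of_nonneg (g := w)
    · rwa [uIcc_of_le hab]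
    · rw [min_eq_left hab, max_eq_right hab]
      exact fun x hx => (hwd x hx).hasDerivAt
    · rwa [min_eq_left hab, max_eq_right hab]
  rw [intervalIntegral.integral_mul_deriv_eq_deriv_mul_of_hasDerivAt (v := fun x => u x - m)
    (u' := deriv w) (by rwa [uIcc_of_le hab])
    (by rw [uIcc_of_le hab]; exact hu.sub continuousOn_const)
    (by rw [min_eq_left hab, max_eq_right hab]; exact fun x hx => (hwd x hx).hasDerivAt)
    (by rw [min_eq_left hab, max_eq_right hab]; exact fun x hx => (hud x hx).sub_const m)
    hwi hui]
  have : 0 ≤ ∫ x in a..b, deriv w x * (u x - m) := by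
    rw [intervalIntegral.integral_of_le hab, integral_Ioc_eq_integral_Ioo]
    exact setIntegral_nonneg measurableSet_Ioo fun x hx =>
      mul_nonneg (hw0 x hx) (sub_nonneg.2 (hum x (Ioo_subset_Icc_self hx)))
  linarith

/-- The Caputo derivative is nonpositive at a minimum. -/
lemma caputo_integral_nonpos_of_isMinOn {α t : ℝ} (hα : 0 < α) (hα1 : α < 1) (ht : 0 < t)
    {y : ℝ → ℝ} (hy : ContinuousOn y (Icc 0 t)) (hyd : ∀ x ∈ Ioc 0 t, DifferentiableAt ℝ y x)
    (hyi : IntervalIntegrable (fun s => (t - s) ^ (-α) * deriv y s) volume 0 t)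
    (hmin : ∀ x ∈ Icc 0 t, y t ≤ y x) :
    ∫ s in (0 : ℝ)..t, (t - s) ^ (-α) * deriv y s ≤ 0 := by
  -- The weight is singular at `t`, so the integral is taken over `[0, r]` first, and `r → t`.
  have hstep : ∀ r ∈ Ico 0 t, ∫ s in (0 : ℝ)..r, (t - s) ^ (-α) * deriv y s ≤
      (t - r) ^ (-α) * (y r - y t) := by
    intro r hr
    have hsub : Icc 0 r ⊆ Icc 0 t := Icc_subset_Icc_right hr.2.le
    have hpos : ∀ x ∈ Icc 0 r, 0 < t - x := fun x hx => by linarith [hx.2, hr.2]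
    have hwc : ContinuousOn (fun s => (t - s) ^ (-α)) (Icc 0 r) := fun x hx =>
      ((continuousAt_const.sub continuousAt_id).rpow_const
        (Or.inl (hpos x hx).ne')).continuousWithinAt
    have hderiv : IntervalIntegrable (deriv y) volume 0 r := by
      have h1 : IntervalIntegrable (fun s => (t - s) ^ (-α) * deriv y s) volume 0 r :=
        hyi.mono_set (by rw [uIcc_of_le hr.1, uIcc_of_le ht.le]; exact hsub)
      have h2 : ContinuousOn (fun s => (t - s) ^ α) (uIcc 0 r) := fun x hx =>
        ((continuousAt_const.sub continuousAt_id).rpow_const (Or.inr hα.le)).continuousWithinAt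
      refine (h1.continuousOn_mul h2).congr fun s hs => ?_
      rw [uIoc_of_le hr.1] at hs
      have h0 := hpos s (Ioc_subset_Icc_self hs)
      rw [← mul_assoc, ← Real.rpow_add h0, add_neg_cancel, Real.rpow_zero, one_mul]
    have h := integral_monotone_mul_deriv_le (m := y t) (w := fun s => (t - s) ^ (-α)) hr.1 hwc
      (fun x hx z hz hxz => Real.rpow_le_rpow_of_nonpos (hpos z hz) (by linarith) (by linarith))
      (fun x hx => ((differentiableAt_const t).sub differentiableAt_id).rpow_const
        (Or.inl (hpos x (Ioo_subset_Icc_self hx)).ne'))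
      (hy.mono hsub) (fun x hx => (hyd x ⟨hx.1, hx.2.le.trans hr.2.le⟩).hasDerivAt) hderiv
      (fun x hx => hmin x (hsub hx))
    have h3 : 0 ≤ (t - 0) ^ (-α) * (y 0 - y t) :=
      mul_nonneg (Real.rpow_nonneg (by linarith) _) (sub_nonneg.2 (hmin 0 ⟨le_rfl, ht.le⟩))
    linarith
  have hmem : Ico 0 t ∈ 𝓝[<] t := Ico_mem_nhdsLT ht
  have hL : Tendsto (fun r => ∫ s in (0 : ℝ)..r, (t - s) ^ (-α) * deriv y s) (𝓝[<] t)
      (𝓝 (∫ s in (0 : ℝ)..t, (t - s) ^ (-α) * deriv y s)) := by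
    have hc := intervalIntegral.continuousOn_primitive_interval' hyi left_mem_uIcc
    rw [uIcc_of_le ht.le] at hc
    have := hc t ⟨ht.le, le_rfl⟩
    refine this.mono_left (nhdsWithin_le_iff.2 ?_)
    exact mem_of_superset hmem Ico_subset_Icc_self
  -- The boundary term is `(t - r) ^ (1 - α)` times minus a difference quotient of `y`.
  have hR : Tendsto (fun r => (t - r) ^ (-α) * (y r - y t)) (𝓝[<] t) (𝓝 0) := by
    have hs : Tendsto (slope y t) (𝓝[<] t) (𝓝 (deriv y t)) :=
      (hasDerivAt_iff_tendsto_slope.1 (hyd t ⟨ht, le_rfl⟩).hasDerivAt).mono_left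
        (nhdsWithin_mono _ fun x hx => ne_of_lt hx)
    have hp : Tendsto (fun r => (t - r) ^ (1 - α)) (𝓝[<] t) (𝓝 0) := by
      have : ContinuousAt (fun r => (t - r) ^ (1 - α)) t :=
        (continuousAt_const.sub continuousAt_id).rpow_const (Or.inr (by linarith))
      have h := this.tendsto
      simp only [sub_self, Real.zero_rpow (by linarith : 1 - α ≠ 0)] at h
      exact h.mono_left nhdsWithin_le_nhds
    have hm := (hp.mul hs).neg
    rw [zero_mul, neg_zero] at hm
    refine hm.congr' ?_
    filter_upwards [self_mem_nhdsWithin] with r hr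
    have hr' : 0 < t - r := sub_pos.2 hr
    rw [slope_def_field, show 1 - α = -α + 1 by ring, Real.rpow_add hr', Real.rpow_one]
    have : r - t ≠ 0 := by linarith
    field_simp
    ring
  exact le_of_tendsto_of_tendsto hL hR (mem_of_superset hmem hstep)

/-! ### Sign and monotonicity on the negative half-line -/

lemma continuous_mittagLeffler_rpow {α : ℝ} (hα : 0 < α) (μ : ℝ) :
    Continuous fun s : ℝ => mittagLeffler α 1 (μ * s ^ α) :=
  (continuous_mittagLeffler hα).comp
    (continuous_const.mul (Real.continuous_rpow_const hα.le))

/-- Were the minimum of `y s = E_α(-x s ^ α)` over `[0, 1]` negative, then at that point the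
eigenvalue equation would make the Caputo derivative positive. -/
lemma mittagLeffler_nonneg {α : ℝ} (hα : 0 < α) (hα1 : α < 1) {z : ℝ} (hz : z ≤ 0) :
    0 ≤ mittagLeffler α 1 z := by
  have hcont := continuous_mittagLeffler_rpow hα z
  obtain ⟨t, ht, hmin⟩ := isCompact_Icc.exists_isMinOn (nonempty_Icc.2 (zero_le_one' ℝ))
    hcont.continuousOn
  have hle : mittagLeffler α 1 (z * t ^ α) ≤ mittagLeffler α 1 z := by
    simpa using hmin (right_mem_Icc.2 (zero_le_one' ℝ))
  by_contra! hneg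
  have htneg := hle.trans_lt hneg
  have ht0 : 0 < t := by
    refine lt_of_le_of_ne ht.1 ?_
    rintro rfl
    rw [Real.zero_rpow hα.ne', mul_zero, mittagLeffler_zero] at htneg
    linarith
  have hz0 : z < 0 := lt_of_le_of_ne hz (by
    rintro rfl; rw [mittagLeffler_zero] at hneg; linarith)
  have hcap := caputo_mittagLeffler hα hα1 z ht0
  have h := caputo_integral_nonpos_of_isMinOn hα hα1 ht0 hcont.continuousOn
    (fun x hx => (hasDerivAt_mittagLeffler_rpow hα z hx.1).differentiableAt) hcap.1
    (fun x hx => hmin ⟨hx.1, hx.2.trans ht.2⟩)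
  rw [hcap.2] at h
  have hΓ := Real.Gamma_pos_of_pos (sub_pos.2 hα1)
  have := mul_pos_of_neg_of_neg (mul_neg_of_pos_of_neg hΓ hz0) htneg
  linarith

/-- For `μ ≤ ν ≤ 0` the difference `w s = E_α(ν s ^ α) - E_α(μ s ^ α)` vanishes at `0` and has
Caputo derivative `μ w s + (ν - μ) E_α(ν s ^ α)`, whose second term is nonnegative. At a negative
minimum over `[0, 1]` this would be positive. -/
lemma mittagLeffler_monotoneOn {α : ℝ} (hα : 0 < α) (hα1 : α < 1) :
    MonotoneOn (mittagLeffler α 1) (Iic 0) := by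
  intro μ hμ ν hν hμν
  simp only [mem_Iic] at hμ hν
  set yμ : ℝ → ℝ := fun s => mittagLeffler α 1 (μ * s ^ α) with hyμ
  set yν : ℝ → ℝ := fun s => mittagLeffler α 1 (ν * s ^ α) with hyν
  have hcont : Continuous fun s => yν s - yμ s :=
    (continuous_mittagLeffler_rpow hα ν).sub (continuous_mittagLeffler_rpow hα μ)
  obtain ⟨t, ht, hmin⟩ := isCompact_Icc.exists_isMinOn (nonempty_Icc.2 (zero_le_one' ℝ))
    hcont.continuousOn
  have hle : yν t - yμ t ≤ mittagLeffler α 1 ν - mittagLeffler α 1 μ := by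
    simpa [hyμ, hyν] using hmin (right_mem_Icc.2 (zero_le_one' ℝ))
  by_contra! hneg
  have htneg : yν t - yμ t < 0 := by linarith
  have ht0 : 0 < t := by
    refine lt_of_le_of_ne ht.1 ?_
    rintro rfl
    simp [hyμ, hyν, Real.zero_rpow hα.ne'] at htneg
  have hμ0 : μ < 0 := by
    refine lt_of_le_of_ne hμ ?_
    rintro rfl
    rw [le_antisymm hν hμν] at hneg
    exact lt_irrefl _ hneg
  have hdμ : ∀ x, 0 < x → DifferentiableAt ℝ yμ x := fun x hx =>
    (hasDerivAt_mittagLeffler_rpow hα μ hx).differentiableAt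
  have hdν : ∀ x, 0 < x → DifferentiableAt ℝ yν x := fun x hx =>
    (hasDerivAt_mittagLeffler_rpow hα ν hx).differentiableAt
  obtain ⟨hiμ, hcμ⟩ := caputo_mittagLeffler hα hα1 μ ht0
  obtain ⟨hiν, hcν⟩ := caputo_mittagLeffler hα hα1 ν ht0
  have heq : ∀ s ∈ uIoc 0 t, (t - s) ^ (-α) * deriv yν s - (t - s) ^ (-α) * deriv yμ s =
      (t - s) ^ (-α) * deriv (fun s => yν s - yμ s) s := by
    intro s hs
    rw [uIoc_of_le ht0.le] at hs
    rw [deriv_fun_sub (hdν s hs.1) (hdμ s hs.1)]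
    ring
  have h := caputo_integral_nonpos_of_isMinOn hα hα1 ht0 hcont.continuousOn
    (fun x hx => (hdν x hx.1).sub (hdμ x hx.1)) ((hiν.sub hiμ).congr heq)
    (fun x hx => hmin ⟨hx.1, hx.2.trans ht.2⟩)
  rw [← intervalIntegral.integral_congr_ae (Eventually.of_forall heq),
    intervalIntegral.integral_sub hiν hiμ, hcν, hcμ] at h
  have hΓ := Real.Gamma_pos_of_pos (sub_pos.2 hα1)
  have hν0 : 0 ≤ yν t := mittagLeffler_nonneg hα hα1
    (mul_nonpos_of_nonpos_of_nonneg hν (Real.rpow_nonneg ht0.le _))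
  have h1 : 0 < μ * (yν t - yμ t) := mul_pos_of_neg_of_neg hμ0 htneg
  have h2 : 0 ≤ (ν - μ) * yν t := mul_nonneg (by linarith) hν0
  have h3 : 0 < Real.Gamma (1 - α) * (μ * (yν t - yμ t) + (ν - μ) * yν t) := by positivity
  change Real.Gamma (1 - α) * ν * yν t - Real.Gamma (1 - α) * μ * yμ t ≤ 0 at h
  nlinarith

/-! ### The Atangana-Baleanu derivative at an extremum -/

lemma abDeriv_neg (α a : ℝ) (f : ℝ → ℝ) (t : ℝ) :
    abDeriv α a (fun x => -f x) t = -abDeriv α a f t := by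
  simp [abDeriv]

lemma abDeriv_le_of_isMinOn {T : ℝ} {f : ℝ → ℝ} (hf : ContDiffOn ℝ 1 f (Icc 0 T)) {t₀ : ℝ}
    (ht₀ : t₀ ∈ Icc 0 T) (hmin : IsMinOn f (Icc 0 T) t₀) {α : ℝ} (hα : 0 < α) (hα1 : α < 1) :
    abDeriv α 0 f t₀ ≤
        1 / (1 - α) * mittagLeffler α 1 (-α * (t₀ ^ α / (1 - α))) * (f t₀ - f 0) ∧
      1 / (1 - α) * mittagLeffler α 1 (-α * (t₀ ^ α / (1 - α))) * (f t₀ - f 0) ≤ 0 := by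
  have hq : 0 < 1 - α := by linarith
  have harg : ∀ x : ℝ, 0 ≤ x → -α * (x ^ α / (1 - α)) ≤ 0 := fun x hx =>
    mul_nonpos_of_nonpos_of_nonneg (by linarith) (div_nonneg (Real.rpow_nonneg hx _) hq.le)
  have hE := mittagLeffler_nonneg hα hα1 (harg t₀ ht₀.1)
  have hf0 : f t₀ ≤ f 0 := hmin ⟨le_rfl, ht₀.1.trans ht₀.2⟩
  refine ⟨?_, mul_nonpos_of_nonneg_of_nonpos (by positivity) (by linarith)⟩
  rcases ht₀.1.eq_or_lt with rfl | htpos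
  · simp [abDeriv]
  have hT : 0 < T := htpos.trans_le ht₀.2
  have hsub : Icc 0 t₀ ⊆ Icc 0 T := Icc_subset_Icc_right ht₀.2
  have hdiff : ∀ x ∈ Ioo 0 t₀, HasDerivAt f (deriv f x) x := fun x hx =>
    ((hf.differentiableOn one_ne_zero x (hsub (Ioo_subset_Icc_self hx))).differentiableAt
      (Icc_mem_nhds hx.1 (hx.2.trans_le ht₀.2))).hasDerivAt
  have hderiv : IntervalIntegrable (deriv f) volume 0 t₀ := by
    have hc : ContinuousOn (derivWithin f (Icc 0 T)) (uIcc 0 t₀) := by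
      rw [uIcc_of_le htpos.le]
      exact (hf.continuousOn_derivWithin (uniqueDiffOn_Icc hT) le_rfl).mono hsub
    refine hc.intervalIntegrable.congr_ae ?_
    rw [uIoc_of_le htpos.le, ← restrict_Ioo_eq_restrict_Ioc]
    filter_upwards [ae_restrict_mem measurableSet_Ioo] with x hx
    exact derivWithin_of_mem_nhds (Icc_mem_nhds hx.1 (hx.2.trans_le ht₀.2))
  set w : ℝ → ℝ := fun s => mittagLeffler α 1 (-α * ((t₀ - s) ^ α / (1 - α))) with hw
  have hwc : Continuous w := (continuous_mittagLeffler hα).comp (continuous_const.mul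
    (((Real.continuous_rpow_const hα.le).comp (continuous_const.sub continuous_id)).div_const _))
  have hwm : MonotoneOn w (Icc 0 t₀) := by
    intro x hx z hz hxz
    refine mittagLeffler_monotoneOn hα hα1 (harg _ (sub_nonneg.2 hx.2))
      (harg _ (sub_nonneg.2 hz.2)) (mul_le_mul_of_nonpos_left ?_ (by linarith))
    have := sub_nonneg.2 hz.2
    gcongr
  have hwd : ∀ x ∈ Ioo 0 t₀, DifferentiableAt ℝ w x := by
    intro x hx
    have h1 : DifferentiableAt ℝ (fun s => -α * ((t₀ - s) ^ α / (1 - α))) x :=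
      ((((differentiableAt_const t₀).sub differentiableAt_id).rpow_const
        (Or.inl (sub_pos.2 hx.2).ne')).div_const _).const_mul _
    exact (hasDerivAt_mittagLeffler hα _).differentiableAt.comp x h1
  have h := integral_monotone_mul_deriv_le (m := f t₀) htpos.le hwc.continuousOn hwm hwd
    (hf.continuousOn.mono hsub) hdiff hderiv fun x hx => hmin (hsub hx)
  have hw0 : w 0 = mittagLeffler α 1 (-α * (t₀ ^ α / (1 - α))) := by simp [hw]
  rw [sub_self, mul_zero, zero_sub, hw0] at h
  have hI : abDeriv α 0 f t₀ = 1 / (1 - α) * ∫ s in (0 : ℝ)..t₀, w s * deriv f s := by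
    simp only [abDeriv, hw, mul_comm (deriv f _)]
  rw [hI, mul_assoc]
  exact mul_le_mul_of_nonneg_left (by linarith) (by positivity)

theorem lemmal7 (T : ℝ) (f : ℝ → ℝ) (hf : ContDiffOn ℝ 1 f (Icc 0 T)) :
    (∀ t₀ ∈ Icc 0 T, IsMaxOn f (Icc 0 T) t₀ → ∀ α : ℝ, 0 < α → α < 1 →
      abDeriv α 0 f t₀ ≥
          1 / (1 - α) * mittagLeffler α 1 (-α * (t₀ ^ α / (1 - α))) * (f t₀ - f 0) ∧
        1 / (1 - α) * mittagLeffler α 1 (-α * (t₀ ^ α / (1 - α))) * (f t₀ - f 0) ≥ 0) ∧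
    (∀ t₀ ∈ Icc 0 T, IsMinOn f (Icc 0 T) t₀ → ∀ α : ℝ, 0 < α → α < 1 →
      abDeriv α 0 f t₀ ≤
          1 / (1 - α) * mittagLeffler α 1 (-α * (t₀ ^ α / (1 - α))) * (f t₀ - f 0) ∧
        1 / (1 - α) * mittagLeffler α 1 (-α * (t₀ ^ α / (1 - α))) * (f t₀ - f 0) ≤ 0) := by
  refine ⟨fun t₀ ht₀ hmax α hα hα1 => ?_, fun t₀ ht₀ hmin α hα hα1 =>
    abDeriv_le_of_isMinOn hf ht₀ hmin hα hα1⟩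
  have h := abDeriv_le_of_isMinOn (f := fun x => -f x) hf.neg ht₀ hmax.neg hα hα1
  rw [abDeriv_neg] at h
  constructor <;> linarith [h.1, h.2]
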